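/- Consider a two-tier network seen from a typical vehicle at the origin. Macro base stations (MBSs) form a homogeneous Poisson point process of density $\lambda_m>0$ in the plane; small base stations (SBSs) on the road through the vehicle form an independent homogeneous Poisson point process of density $\lambda_s>0$ on that line. Each MBS carries a shadowing coefficient with the law of $\chi_M$ and each of these SBSs one with the law of $\chi_S$, where $10\log_{10}\chi_i$ is normal with mean $\omega_i$ and variance $\delta_i^2$; all shadowing coefficients are independent of each other and of the positions. Let $\alpha_M,\alpha_S>0$ be the path-loss exponents. Shadowing is absorbed into the positions by moving an MBS (an SBS) at $x$ with shadowing coefficient $\chi$ to $y=\chi^{-1/\alpha_M}x$ (to $y=\chi^{-1/\alpha_S}x$). Let $X_M$ and $X_S$ be the distances from the vehicle to the nearest displaced MBS and to the nearest displaced SBS on its road, and let $\lambda_M=\mathbb E[\chi_M^{2/\alpha_M}]\lambda_m$, $\lambda_S=\mathbb E[\chi_S^{1/\alpha_S}]\lambda_s$. Let $P_M,P_S,P_V>0$ be the transmit powers of MBSs, SBSs and vehicles, and $G_M,G_{S,0},G_{V,0},G_{V,1}>0$ the antenna gains of an MBS, of the main lobe of an SBS, and of the main and side lobes of a vehicle.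 In the downlink (DL) the vehicle is associated with an MBS if $P_MG_MX_M^{-\alpha_M}>P_SG_{S,0}X_S^{-\alpha_S}$, and with an SBS otherwise; in the uplink (UL) it is associated with an MBS if $P_VG_{V,1}X_M^{-\alpha_M}>P_VG_{V,0}X_S^{-\alpha_S}$, and with an SBS otherwise. Case 3 is the event that UL is with an MBS and DL with an SBS; Case 4 is the event that UL and DL are both with SBSs. Put $A_{M,S}=\frac{P_MG_M}{P_SG_{S,0}}$ and $B_{M,S}=\frac{P_VG_{V,1}}{P_VG_{V,0}}$, and assume $A_{M,S}>B_{M,S}$. Then $$\Pr(\text{Case }4)=\Pr\left(A_{M,S}X_M^{-\alpha_M}<X_S^{-\alpha_S},\ B_{M,S}X_M^{-\alpha_M}<X_S^{-\alpha_S}\right)=\int_0^\infty 2\lambda_S\exp\left(-\lambda_M\pi A_{M,S}^{2/\alpha_M}x^{2\alpha_S/\alpha_M}-2\lambda_Sx\right)dx,$$ where the integral converges. If $\alpha_S=\alpha_M=\alpha$, then $$\Pr(\text{Case }4)=\sqrt{\frac{\lambda_S^2}{\lambda_MA_{M,S}^{2/\alpha}}}\,\exp\left(\frac{\lambda_S^2}{\lambda_M\pi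 A_{M,S}^{2/\alpha}}\right)\operatorname{erfc}\left(\frac{\lambda_S}{\sqrt{\lambda_M\pi A_{M,S}^{2/\alpha}}}\right),\qquad \operatorname{erfc}(z)=\frac{2}{\sqrt\pi}\int_z^\infty e^{-t^2}\,dt.$$ Moreover, $\Pr(\text{Case }3)=0$. -/

import Mathlib

open MeasureTheory ProbabilityTheory
open scoped NNReal ENNReal

noncomputable section

/-- The complementary error function `erfc x = (2 / √π) ∫_x^∞ exp (-t²) dt`. -/
def erfc (x : ℝ) : ℝ :=
  2 / Real.sqrt Real.pi * ∫ t in Set.Ioi x, Real.exp (-t ^ 2)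

/-- The number of points of the configuration `X 0 w, X 1 w, …` that lie in `B`. -/
def pointCount {Ω E : Type*} (X : ℕ → Ω → E) (B : Set E) (w : Ω) : ℕ∞ :=
  {n : ℕ | X n w ∈ B}.encard

/-- The random points `X 0, X 1, …` of `E` (listed in any order) form a Poisson point process with
intensity measure `Λ`: the number of points in a measurable set `B` of finite intensity is Poisson
distributed with mean `Λ B`, and the numbers of points in pairwise disjoint sets are independent. -/
structure IsPoissonProcess {Ω E : Type*} [MeasurableSpace Ω] [MeasurableSpace E]
    (X : ℕ → Ω → E) (Λ : Measure E) (P : Measure Ω) : Prop where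
  measurable : ∀ n, Measurable (X n)
  count_law : ∀ B : Set E, MeasurableSet B → Λ B ≠ ∞ → ∀ k : ℕ,
    P {w | pointCount X B w = k} = poissonMeasure (Λ B).toNNReal {k}
  count_indep : ∀ (m : ℕ) (B : Fin m → Set E), (∀ i, MeasurableSet (B i)) →
    (∀ i, Λ (B i) ≠ ∞) → Pairwise (Function.onFun Disjoint B) →
    iIndepFun (fun i => pointCount X (B i)) P

/-- The law of a log-normal shadowing coefficient `χ` given in decibels, that is,
`10 log₁₀ χ` is normal with mean `ω` and standard deviation `δ`. -/
def logNormalDB (ω : ℝ) (δ : ℝ≥0) : Measure ℝ :=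
  (gaussianReal ω (δ ^ 2)).map (fun z : ℝ => (10 : ℝ) ^ (z / 10))

/-- The points `X n` form a Poisson process of intensity `Λ`, and the point `X n` carries the mark
`χ n`; the marks are independent with common law `ν` and independent of the points. -/
structure IsIndepMarkedPoisson {Ω E : Type*} [MeasurableSpace Ω] [MeasurableSpace E]
    (X : ℕ → Ω → E) (χ : ℕ → Ω → ℝ) (Λ : Measure E) (ν : Measure ℝ) (P : Measure Ω) : Prop where
  points : IsPoissonProcess X Λ P
  marks_measurable : ∀ n, Measurable (χ n)
  marks_law : ∀ n, P.map (χ n) = ν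
  marks_indep : iIndepFun χ P
  marks_indep_points : IndepFun (fun w n => X n w) (fun w n => χ n w) P

/-- The random displacement `y = χ ^ (-1/α) x`, which absorbs the shadowing coefficient `χ` into
the path loss: `χ ‖x‖ ^ (-α) = ‖y‖ ^ (-α)`. -/
def displaced {Ω E : Type*} [SMul ℝ E] (α : ℝ) (X : ℕ → Ω → E) (χ : ℕ → Ω → ℝ) :
    ℕ → Ω → E :=
  fun n w => (χ n w) ^ (-(1 / α)) • X n w

/-- The distance from the origin to the nearest of the points `Y 0 w, Y 1 w, …`. -/
def nearestDist {Ω E : Type*} [Norm E] (Y : ℕ → Ω → E) (w : Ω) : ℝ :=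
  ⨅ n, ‖Y n w‖

/-- A vehicle at distance `xM` from the nearest MBS and `xS` from the nearest SBS is associated
with the MBS when the power received over the MBS link, with power-gain product `gM`, exceeds the
power received over the SBS link, with power-gain product `gS`; otherwise with the SBS. -/
def AssocMBS (gM gS αM αS xM xS : ℝ) : Prop :=
  gM * xM ^ (-αM) > gS * xS ^ (-αS)

end

/-! Since `B < A`, a downlink association with an SBS forces the uplink association with an SBS. So
Case 3 is empty and Case 4 is the single inequality `A * xM ^ (-αM) ≤ xS ^ (-αS)`, that is, almost
surely `A ^ (1 / αM) * xS ^ (αS / αM) ≤ xM`. The two distances are independent, so the probability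
is the survival function of `xM` at the left side, integrated against the law of `xS`.

Both laws are void probabilities of marked Poisson processes (`measure_forall_notMem`). Given the
points, the independent marks avoid `C` with probability `∏ₙ (1 - ν (C at Xₙ))`, and the mean of
this product is the generating functional `lintegral_iInf_prod`. Integrating the intensity of a ball
over the mark (`measure_le_nearestDist_displaced`) gives the survival function `exp (-lamM π r²)`
for `xM` and the exponential law of rate `2 * lamS` for `xS`. For equal exponents the integral is
half-Gaussian, whence `erfc`. -/

/-! ### Generating functional of a Poisson process -/

lemma lintegral_pow_poissonMeasure (r : ℝ≥0) {b : ℝ} (hb : 0 ≤ b) :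
    ∫⁻ k, ENNReal.ofReal b ^ k ∂(poissonMeasure r) =
      ENNReal.ofReal (Real.exp (-((1 - b) * r))) := by
  have hsum : HasSum (fun k : ℕ => Real.exp (-(r : ℝ)) * ((b * r) ^ k / (k.factorial : ℝ)))
      (Real.exp (-((1 - b) * r))) := by
    have h : HasSum (fun k : ℕ => (b * r) ^ k / (k.factorial : ℝ)) (Real.exp (b * r)) := by
      rw [Real.exp_eq_exp_ℝ]
      exact NormedSpace.expSeries_div_hasSum_exp (b * r)
    have h2 := h.mul_left (Real.exp (-(r : ℝ)))
    rw [← Real.exp_add] at h2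
    convert! h2 using 2
    ring
  rw [lintegral_countable', ← hsum.tsum_eq, ENNReal.ofReal_tsum_of_nonneg _ hsum.summable]
  · refine tsum_congr fun k => ?_
    rw [poissonMeasure_singleton, ← ENNReal.ofReal_pow hb, ← ENNReal.ofReal_mul (by positivity)]
    congr 1
    rw [mul_pow]
    ring
  · intro k
    positivity

lemma tendsto_prod_range_ite {p : ℕ → Prop} [DecidablePred p] (hp : {n | p n}.Finite) {b : ℝ≥0∞} :
    Filter.Tendsto (fun N => ∏ n ∈ Finset.range N, (if p n then b else 1)) Filter.atTop
      (nhds (b ^ {n | p n}.encard.toNat)) := by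
  obtain ⟨N₀, hN₀⟩ := hp.bddAbove
  refine tendsto_const_nhds.congr' ?_
  filter_upwards [Filter.eventually_gt_atTop N₀] with N hN
  rw [Finset.prod_ite, Finset.prod_const, Finset.prod_const_one, mul_one]
  congr 1
  have : {n | p n} = ((Finset.range N).filter p : Set ℕ) := by
    ext n
    simp only [Set.mem_ofPred_eq, Finset.coe_filter, Finset.mem_range]
    exact ⟨fun h => ⟨(hN₀ h).trans_lt hN, h⟩, fun h => h.2⟩
  rw [this, Set.encard_coe_eq_coe_finsetCard]
  rfl

namespace IsPoissonProcess

variable {Ω E : Type*} [MeasurableSpace Ω] [MeasurableSpace E] {X : ℕ → Ω → E} {Λ : Measure E}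
  {P : Measure Ω}

lemma measurable_pointCount (hX : IsPoissonProcess X Λ P) {B : Set E} (hB : MeasurableSet B) :
    Measurable (pointCount X B) := by
  rw [ENat.measurable_iff]
  intro k
  -- There are only countably many finite index sets, so the union over the set of indices landing
  -- in `B` is countable.
  have : pointCount X B ⁻¹' {(k : ℕ∞)} =
      ⋃ s : {s : Finset ℕ // s.card = k}, ⋂ n, {w | X n w ∈ B ↔ n ∈ s.1} := by
    ext w
    simp only [pointCount, Set.mem_preimage, Set.mem_singleton_iff, Set.mem_iUnion, Set.mem_iInter,
      Set.mem_ofPred_eq]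
    constructor
    · intro h
      have hf : {n | X n w ∈ B}.Finite := Set.finite_of_encard_eq_coe h
      refine ⟨⟨hf.toFinset, ?_⟩, fun n => by simp⟩
      rw [hf.encard_eq_coe_toFinset_card] at h
      exact_mod_cast h
    · rintro ⟨⟨s, hs⟩, h⟩
      have : {n | X n w ∈ B} = (s : Set ℕ) := by ext n; simpa using h n
      rw [this, Set.encard_coe_eq_coe_finsetCard, hs]
  rw [this]
  refine MeasurableSet.iUnion fun s => MeasurableSet.iInter fun n => ?_
  by_cases h : n ∈ s.1
  · simp only [h, iff_true]
    exact hX.measurable n hB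
  · simp only [h, iff_false]
    exact (hX.measurable n hB).compl

/-- The Poisson weights already sum to one, leaving no mass for an infinite count. -/
lemma ae_pointCount_ne_top [IsProbabilityMeasure P] (hX : IsPoissonProcess X Λ P) {B : Set E} (hB : MeasurableSet B)
    (hfin : Λ B ≠ ∞) : ∀ᵐ w ∂P, pointCount X B w ≠ ⊤ := by
  have hm : ∀ k : ℕ, MeasurableSet {w | pointCount X B w = k} := fun k =>
    hX.measurable_pointCount hB (measurableSet_singleton _)
  have hU : P (⋃ k : ℕ, {w | pointCount X B w = k}) = 1 := by
    rw [measure_iUnion _ hm, tsum_congr fun k => hX.count_law B hB hfin k]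
    · simpa using (lintegral_countable' (μ := poissonMeasure (Λ B).toNNReal) 1).symm
    · intro i j hij
      refine Set.disjoint_left.2 fun w hi hj => hij ?_
      simp only [Set.mem_ofPred_eq] at hi hj
      exact_mod_cast hi.symm.trans hj
  have := (prob_compl_eq_zero_iff (MeasurableSet.iUnion hm)).2 hU
  filter_upwards [compl_mem_ae_iff.2 this] with w hw htop
  simp [htop] at hw

lemma map_toNat_pointCount [IsProbabilityMeasure P] (hX : IsPoissonProcess X Λ P) {B : Set E} (hB : MeasurableSet B)
    (hfin : Λ B ≠ ∞) :
    P.map (fun w => (pointCount X B w).toNat) = poissonMeasure (Λ B).toNNReal := by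
  have hm : Measurable fun w => (pointCount X B w).toNat :=
    Measurable.of_discrete.comp (hX.measurable_pointCount hB)
  refine Measure.ext_of_singleton fun k => ?_
  rw [Measure.map_apply hm (measurableSet_singleton k), ← hX.count_law B hB hfin k]
  refine measure_congr ?_
  filter_upwards [hX.ae_pointCount_ne_top hB hfin] with w hw
  obtain ⟨j, hj⟩ := ENat.ne_top_iff_exists.1 hw
  refine propext (?_ : (pointCount X B w).toNat = k ↔ pointCount X B w = k)
  rw [← hj]
  simp

lemma iIndepFun_pointCount (hX : IsPoissonProcess X Λ P) {ι : Type*} [Fintype ι]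
    {B : ι → Set E} (hB : ∀ i, MeasurableSet (B i)) (hfin : ∀ i, Λ (B i) ≠ ∞)
    (hdisj : Pairwise (Function.onFun Disjoint B)) :
    iIndepFun (fun i => pointCount X (B i)) P := by
  let e := Fintype.equivFin ι
  have h := hX.count_indep _ (fun j => B (e.symm j)) (fun _ => hB _) (fun _ => hfin _)
    fun i j hij => hdisj (e.symm.injective.ne hij)
  have h2 := h.precomp e.injective
  simpa using h2

variable [IsProbabilityMeasure P]

open Classical in
-- Exchanging the products turns the product over points into `∏ i, b i ^ (count in B i)`, a product
-- of independent factors. All factors are at most 1, so the infimum of the partial products is the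
-- infinite product.
lemma lintegral_iInf_prod_step (hX : IsPoissonProcess X Λ P) {ι : Type*} [Fintype ι]
    {B : ι → Set E} (hB : ∀ i, MeasurableSet (B i)) (hfin : ∀ i, Λ (B i) ≠ ∞)
    (hdisj : Pairwise (Function.onFun Disjoint B)) {b : ι → ℝ} (h0 : ∀ i, 0 ≤ b i)
    (h1 : ∀ i, b i ≤ 1) :
    ∫⁻ w, ⨅ N : ℕ, ∏ n ∈ Finset.range N, ∏ i, (if X n w ∈ B i then ENNReal.ofReal (b i) else 1) ∂P
      = ENNReal.ofReal (Real.exp (-∑ i, (1 - b i) * (Λ (B i)).toReal)) := by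
  have hae : ∀ᵐ w ∂P, ∀ i, pointCount X (B i) w ≠ ⊤ :=
    ae_all_iff.2 fun i => hX.ae_pointCount_ne_top (hB i) (hfin i)
  have hle : ∀ w n, ∏ i, (if X n w ∈ B i then ENNReal.ofReal (b i) else 1) ≤ 1 := fun w n =>
    Finset.prod_le_one' fun i _ => by
      split_ifs
      · exact ENNReal.ofReal_le_one.2 (h1 i)
      · exact le_rfl
  have hcongr : ∀ᵐ w ∂P,
      ⨅ N : ℕ, ∏ n ∈ Finset.range N, ∏ i, (if X n w ∈ B i then ENNReal.ofReal (b i) else 1) =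
        ∏ i, ENNReal.ofReal (b i) ^ (pointCount X (B i) w).toNat := by
    filter_upwards [hae] with w hw
    refine tendsto_nhds_unique (tendsto_atTop_iInf ?_) ?_
    · refine antitone_nat_of_succ_le fun N => ?_
      rw [Finset.prod_range_succ]
      exact mul_le_of_le_one_right' (hle w N)
    · simp_rw [Finset.prod_comm (s := Finset.range _)]
      refine ENNReal.tendsto_finsetProd_of_ne_top _ (fun i _ => ?_)
        fun i _ => ENNReal.pow_ne_top ENNReal.ofReal_ne_top
      exact tendsto_prod_range_ite (Set.encard_ne_top_iff.1 (hw i))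
  rw [lintegral_congr_ae hcongr]
  have hind := (hX.iIndepFun_pointCount hB hfin hdisj).comp
    (fun i k => ENNReal.ofReal (b i) ^ k.toNat) fun i => Measurable.of_discrete
  have hmeas : ∀ i, Measurable ((fun k : ℕ∞ => ENNReal.ofReal (b i) ^ k.toNat) ∘
      pointCount X (B i)) := fun i =>
    Measurable.of_discrete.comp (hX.measurable_pointCount (hB i))
  have hprod := lintegral_prod_eq_prod_lintegral_of_indepFun Finset.univ _ hind hmeas
  simp only [Function.comp_apply] at hprod
  rw [hprod, ← Finset.sum_neg_distrib, Real.exp_sum,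
    ENNReal.ofReal_prod_of_nonneg fun i _ => (Real.exp_pos _).le]
  refine Finset.prod_congr rfl fun i _ => ?_
  have hm : Measurable fun w => (pointCount X (B i) w).toNat :=
    Measurable.of_discrete.comp (hX.measurable_pointCount (hB i))
  have := lintegral_map (μ := P) (f := fun k : ℕ => ENNReal.ofReal (b i) ^ k)
    Measurable.of_discrete hm
  rw [← this, hX.map_toNat_pointCount (hB i) (hfin i), lintegral_pow_poissonMeasure _ (h0 i)]
  rfl

lemma lintegral_iInf_prod_simpleFunc (hX : IsPoissonProcess X Λ P) (h : SimpleFunc E ℝ≥0∞)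
    (h1 : ∀ x, h x ≤ 1) (hint : ∫⁻ x, h x ∂Λ ≠ ∞) :
    ∫⁻ w, ⨅ N : ℕ, ∏ n ∈ Finset.range N, (1 - h (X n w)) ∂P
      = ENNReal.ofReal (Real.exp (-(∫⁻ x, h x ∂Λ).toReal)) := by
  classical
  -- The value 0 is dropped because its level set may have infinite intensity; the others are finite
  -- by `hint`.
  let S : Finset ℝ≥0∞ := h.range.erase 0
  have hS : ∀ i : S, i.1 ≠ 0 ∧ i.1 ≤ 1 := fun i => by
    obtain ⟨hi0, hi⟩ := Finset.mem_erase.1 i.2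
    obtain ⟨x, hx⟩ := SimpleFunc.mem_range.1 hi
    exact ⟨hi0, hx ▸ h1 x⟩
  have hlint : ∫⁻ x, h x ∂Λ = ∑ i : S, i.1 * Λ (h ⁻¹' {i.1}) := by
    rw [SimpleFunc.lintegral_eq_lintegral h Λ, SimpleFunc.lintegral,
      Finset.sum_coe_sort S (fun a => a * Λ (h ⁻¹' {a}))]
    refine (Finset.sum_erase _ (by simp)).symm
  have hfin : ∀ i : S, Λ (h ⁻¹' {i.1}) ≠ ∞ := fun i htop => by
    refine hint ?_
    rw [hlint]
    refine ENNReal.sum_eq_top.2 ⟨i, Finset.mem_univ _, ?_⟩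
    rw [htop, ENNReal.mul_top (hS i).1]
  have key := hX.lintegral_iInf_prod_step (B := fun i : S => h ⁻¹' {i.1})
    (fun i => h.measurableSet_fiber _) hfin
    (fun i j hij => Set.disjoint_left.2 fun x hi hj =>
      hij (Subtype.ext (((Set.mem_singleton_iff.1 hi).symm.trans (Set.mem_singleton_iff.1 hj)))))
    (b := fun i => 1 - i.1.toReal)
    (fun i => sub_nonneg.2 (ENNReal.toReal_mono ENNReal.one_ne_top (hS i).2))
    (fun i => sub_le_self _ ENNReal.toReal_nonneg)
  have hsum : ∑ i : S, (1 - (1 - i.1.toReal)) * (Λ (h ⁻¹' {i.1})).toReal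
      = (∫⁻ x, h x ∂Λ).toReal := by
    rw [hlint, ENNReal.toReal_sum fun i _ =>
      ENNReal.mul_ne_top ((hS i).2.trans_lt ENNReal.one_lt_top).ne (hfin i)]
    simp [ENNReal.toReal_mul]
  rw [hsum] at key
  rw [← key]
  refine lintegral_congr fun w => iInf_congr fun N => Finset.prod_congr rfl fun n _ => ?_
  have hof : ∀ i : ℝ≥0∞, i ≤ 1 → ENNReal.ofReal (1 - i.toReal) = 1 - i := fun i hi => by
    rw [ENNReal.ofReal_sub _ ENNReal.toReal_nonneg, ENNReal.ofReal_one,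
      ENNReal.ofReal_toReal (hi.trans_lt ENNReal.one_lt_top).ne]
  simp only [Set.mem_preimage, Set.mem_singleton_iff]
  rw [Finset.prod_coe_sort S fun a => if h (X n w) = a then ENNReal.ofReal (1 - a.toReal) else 1,
    Finset.prod_ite_eq]
  split_ifs with hmem
  · exact (hof _ (h1 _)).symm
  · have : h (X n w) = 0 := by
      by_contra hne
      exact hmem (Finset.mem_erase.2 ⟨hne, SimpleFunc.mem_range_self h _⟩)
    simp [this]

/-- The generating functional `𝔼 [∏ₙ (1 - h (Xₙ))] = exp (-∫ h dΛ)` of a Poisson process. -/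
theorem lintegral_iInf_prod (hX : IsPoissonProcess X Λ P) {h : E → ℝ≥0∞} (hm : Measurable h)
    (h1 : ∀ x, h x ≤ 1) (hint : ∫⁻ x, h x ∂Λ ≠ ∞) :
    ∫⁻ w, ⨅ N : ℕ, ∏ n ∈ Finset.range N, (1 - h (X n w)) ∂P
      = ENNReal.ofReal (Real.exp (-(∫⁻ x, h x ∂Λ).toReal)) := by
  let s := SimpleFunc.eapprox h
  have hsle : ∀ k x, s k x ≤ h x := fun k x => by
    rw [← SimpleFunc.iSup_eapprox_apply hm x]
    exact le_iSup (fun k => s k x) k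
  have hs1 : ∀ k x, s k x ≤ 1 := fun k x => (hsle k x).trans (h1 x)
  have hsint : ∀ k, ∫⁻ x, s k x ∂Λ ≠ ∞ := fun k =>
    ((lintegral_mono (hsle k)).trans_lt hint.lt_top).ne
  have hsmono : ∀ x, Monotone fun k => s k x := fun x i j hij => SimpleFunc.monotone_eapprox h hij x
  have hslim : ∀ x, Filter.Tendsto (fun k => s k x) Filter.atTop (nhds (h x)) := fun x => by
    rw [← SimpleFunc.iSup_eapprox_apply hm x]
    exact tendsto_atTop_iSup (hsmono x)
  have hanti : ∀ N w, Antitone fun k => ∏ n ∈ Finset.range N, (1 - s k (X n w)) :=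
    fun N w i j hij => Finset.prod_le_prod' fun n _ => tsub_le_tsub_left (hsmono _ hij) _
  -- The approximants increase, so the partial products decrease in both `k` and `N`; the limit in
  -- `k` is an infimum and commutes with the one in `N`.
  have hswap : ∀ w, ⨅ N : ℕ, ∏ n ∈ Finset.range N, (1 - h (X n w)) =
      ⨅ k : ℕ, ⨅ N : ℕ, ∏ n ∈ Finset.range N, (1 - s k (X n w)) := fun w => by
    rw [iInf_comm]
    refine iInf_congr fun N => ?_
    refine tendsto_nhds_unique ?_ (tendsto_atTop_iInf (hanti N w))
    refine ENNReal.tendsto_finsetProd_of_ne_top _ (fun n _ => ?_)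
      fun n _ => (tsub_le_self.trans_lt ENNReal.one_lt_top).ne
    exact ENNReal.Tendsto.sub tendsto_const_nhds (hslim _) (Or.inl ENNReal.one_ne_top)
  have hmeas : ∀ k, Measurable fun w => ⨅ N : ℕ, ∏ n ∈ Finset.range N, (1 - s k (X n w)) :=
    fun k => Measurable.iInf fun N => Finset.measurable_fun_prod _ fun n _ =>
      measurable_const.sub ((s k).measurable.comp (hX.measurable n))
  have hanti' : Antitone fun k w => ⨅ N : ℕ, ∏ n ∈ Finset.range N, (1 - s k (X n w)) :=
    fun i j hij w => iInf_mono fun N => hanti N w hij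
  simp_rw [hswap]
  rw [lintegral_iInf hmeas hanti']
  · refine tendsto_nhds_unique
      (tendsto_atTop_iInf fun i j hij => lintegral_mono (hanti' hij)) ?_
    simp_rw [fun k => hX.lintegral_iInf_prod_simpleFunc (s k) (hs1 k) (hsint k)]
    have hl := lintegral_tendsto_of_tendsto_of_monotone (μ := Λ)
      (fun k => (s k).measurable.aemeasurable) (ae_of_all _ hsmono) (ae_of_all _ hslim)
    exact ENNReal.tendsto_ofReal ((Real.continuous_exp.tendsto _).comp
      ((ENNReal.tendsto_toReal hint).comp hl).neg)
  · rw [hX.lintegral_iInf_prod_simpleFunc (s 0) (hs1 0) (hsint 0)]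
    exact ENNReal.ofReal_ne_top

end IsPoissonProcess

/-! ### Void probabilities of marked Poisson processes -/

namespace IsIndepMarkedPoisson

variable {Ω E : Type*} [MeasurableSpace Ω] [MeasurableSpace E] {X : ℕ → Ω → E} {χ : ℕ → Ω → ℝ}
  {Λ : Measure E} {ν : Measure ℝ} {P : Measure Ω} [IsProbabilityMeasure P]
  [IsProbabilityMeasure ν]

/-- Fubini for the joint law of points and marks: with the points frozen, the marks are independent
with law `ν`, and the probability factorises. -/
lemma measure_forall_lt_notMem (hX : IsIndepMarkedPoisson X χ Λ ν P) {C : Set (E × ℝ)}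
    (hC : MeasurableSet C) (N : ℕ) :
    P {w | ∀ n < N, (X n w, χ n w) ∉ C} =
      ∫⁻ w, ∏ n ∈ Finset.range N, (1 - ν (Prod.mk (X n w) ⁻¹' C)) ∂P := by
  have hXm : Measurable fun w n => X n w := measurable_pi_lambda _ hX.points.measurable
  have hχm : Measurable fun w n => χ n w := measurable_pi_lambda _ hX.marks_measurable
  have hlaw := (indepFun_iff_map_prod_eq_prod_map_map hXm.aemeasurable hχm.aemeasurable).1
    hX.marks_indep_points
  let D : Set ((ℕ → E) × (ℕ → ℝ)) := ⋂ n ∈ Finset.range N, {p | (p.1 n, p.2 n) ∈ Cᶜ}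
  have hD : MeasurableSet D := Finset.measurableSet_biInter _ fun n _ =>
    (by fun_prop : Measurable fun p : (ℕ → E) × (ℕ → ℝ) => (p.1 n, p.2 n)) hC.compl
  have hset : {w | ∀ n < N, (X n w, χ n w) ∉ C} =
      (fun w => ((fun n => X n w), fun n => χ n w)) ⁻¹' D := by
    ext w
    simp [D]
  have := Measure.isProbabilityMeasure_map hχm.aemeasurable (μ := P)
  rw [hset, ← Measure.map_apply (hXm.prodMk hχm) hD, hlaw, Measure.prod_apply hD,
    lintegral_map (measurable_measure_prodMk_left hD) hXm]
  refine lintegral_congr fun w => ?_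
  rw [Measure.map_apply hχm (measurable_prodMk_left hD)]
  have hpre : (fun w n => χ n w) ⁻¹' (Prod.mk (fun n => X n w) ⁻¹' D) =
      ⋂ n ∈ Finset.range N, χ n ⁻¹' (Prod.mk (X n w) ⁻¹' Cᶜ) := by
    ext w'
    simp [D]
  rw [hpre, hX.marks_indep.measure_inter_preimage_eq_mul _
    fun n _ => measurable_prodMk_left hC.compl]
  refine Finset.prod_congr rfl fun n _ => ?_
  rw [← Measure.map_apply (hX.marks_measurable n) (measurable_prodMk_left hC.compl),
    hX.marks_law n, Set.preimage_compl, prob_compl_eq_one_sub (measurable_prodMk_left hC)]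

/-- The probability that an independently marked Poisson process has no point in `C`. -/
theorem measure_forall_notMem (hX : IsIndepMarkedPoisson X χ Λ ν P)
    {C : Set (E × ℝ)} (hC : MeasurableSet C) (hfin : ∫⁻ x, ν (Prod.mk x ⁻¹' C) ∂Λ ≠ ∞) :
    P {w | ∀ n, (X n w, χ n w) ∉ C} =
      ENNReal.ofReal (Real.exp (-(∫⁻ x, ν (Prod.mk x ⁻¹' C) ∂Λ).toReal)) := by
  have hm : Measurable fun x => ν (Prod.mk x ⁻¹' C) := measurable_measure_prodMk_left hC
  rw [← hX.points.lintegral_iInf_prod hm (fun _ => prob_le_one) hfin, lintegral_iInf]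
  · have hset : {w | ∀ n, (X n w, χ n w) ∉ C} =
        ⋂ N : ℕ, {w | ∀ n < N, (X n w, χ n w) ∉ C} := by
      ext w
      simp only [Set.mem_ofPred_eq, Set.mem_iInter]
      exact ⟨fun h N n _ => h n, fun h n => h (n + 1) n n.lt_succ_self⟩
    rw [hset, Antitone.measure_iInter]
    · exact iInf_congr fun N => hX.measure_forall_lt_notMem hC N
    · exact fun i j hij w hw n hn => hw n (hn.trans_le hij)
    · intro N
      refine MeasurableSet.nullMeasurableSet ?_
      simp only [Set.ofPred_forall]
      exact MeasurableSet.iInter fun n => MeasurableSet.iInter fun _ =>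
        ((hX.points.measurable n).prodMk (hX.marks_measurable n)) hC.compl
    · exact ⟨0, measure_ne_top _ _⟩
  · exact fun N => Finset.measurable_fun_prod _ fun n _ =>
      measurable_const.sub (hm.comp (hX.points.measurable n))
  · refine antitone_nat_of_succ_le fun N w => ?_
    simp only [Finset.prod_range_succ]
    exact mul_le_of_le_one_right' tsub_le_self
  · simp

end IsIndepMarkedPoisson

/-! ### Moments of log-normal shadowing -/

section LogNormal

variable (ω : ℝ) (δ : ℝ≥0)

lemma measurable_ten_rpow_div_ten : Measurable fun z : ℝ => (10 : ℝ) ^ (z / 10) := by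
  fun_prop

instance isProbabilityMeasure_logNormalDB : IsProbabilityMeasure (logNormalDB ω δ) :=
  Measure.isProbabilityMeasure_map measurable_ten_rpow_div_ten.aemeasurable

lemma ae_pos_logNormalDB : ∀ᵐ c ∂(logNormalDB ω δ), 0 < c := by
  rw [logNormalDB, ae_map_iff measurable_ten_rpow_div_ten.aemeasurable measurableSet_Ioi]
  exact ae_of_all _ fun z => by positivity

lemma integrable_rpow_logNormalDB (p : ℝ) :
    Integrable (fun c : ℝ => c ^ p) (logNormalDB ω δ) := by
  rw [logNormalDB, integrable_map_measure (by fun_prop)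
    measurable_ten_rpow_div_ten.aemeasurable]
  -- Powers of `χ` are exponentials of a Gaussian variable, so every real moment is finite.
  refine (integrable_exp_mul_gaussianReal (Real.log 10 / 10 * p)).congr (ae_of_all _ fun z => ?_)
  simp only [Function.comp_apply]
  rw [← Real.rpow_mul (by norm_num), Real.rpow_def_of_pos (by norm_num)]
  congr 1
  ring

lemma integral_rpow_logNormalDB_pos (p : ℝ) : 0 < ∫ c, c ^ p ∂(logNormalDB ω δ) := by
  rw [integral_pos_iff_support_of_nonneg_ae
    ((ae_pos_logNormalDB ω δ).mono fun c hc => (Real.rpow_pos_of_pos hc p).le)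
    (integrable_rpow_logNormalDB ω δ p)]
  have : Function.support (fun c : ℝ => c ^ p) =ᵐ[logNormalDB ω δ] Set.univ := by
    filter_upwards [ae_pos_logNormalDB ω δ] with c hc
    exact eq_true (Real.rpow_pos_of_pos hc p).ne'
  rw [measure_congr this]
  simp

end LogNormal

/-! ### Law of the nearest displaced point -/

section NearestDist

variable {Ω E : Type*} [NormedAddCommGroup E]

lemma nearestDist_nonneg (Y : ℕ → Ω → E) (w : Ω) : 0 ≤ nearestDist Y w :=
  Real.iInf_nonneg fun _ => norm_nonneg _

/-- The weak inequality needs no attained infimum, which is why survival functions are stated with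
`≤` below. -/
lemma le_nearestDist_iff (Y : ℕ → Ω → E) (w : Ω) (r : ℝ) :
    r ≤ nearestDist Y w ↔ ∀ n, r ≤ ‖Y n w‖ :=
  le_ciInf_iff ⟨0, by rintro _ ⟨n, rfl⟩; exact norm_nonneg _⟩

lemma nearestDist_displaced [NormedSpace ℝ E] (α : ℝ) (X : ℕ → Ω → E) (χ : ℕ → Ω → ℝ) (w : Ω) :
    nearestDist (displaced α X χ) w = ⨅ n, |χ n w ^ (-(1 / α))| * ‖X n w‖ := by
  simp only [nearestDist, displaced, norm_smul, Real.norm_eq_abs]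

variable [MeasurableSpace Ω] [MeasurableSpace E] [BorelSpace E]

/-- Exhibits the distance as a measurable function of the whole marked sequence, so that
independence of the two tiers passes to the distances. -/
lemma measurable_iInf_abs_rpow_mul_norm (α : ℝ) :
    Measurable fun p : ℕ → E × ℝ => ⨅ n, |(p n).2 ^ (-(1 / α))| * ‖(p n).1‖ := by
  refine Measurable.iInf fun n => Measurable.mul ?_ ?_
  · exact measurable_abs.comp ((measurable_snd.comp (measurable_pi_apply n)).pow_const _)
  · exact measurable_norm.comp (measurable_fst.comp (measurable_pi_apply n))

variable [NormedSpace ℝ E]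

/-- The distance to the nearest displaced point has survival function
`exp (-κ 𝔼[χ ^ (d / α)] r ^ d)`, if a ball of radius `s` has intensity `κ s ^ d`. -/
theorem measure_le_nearestDist_displaced {P : Measure Ω} [IsProbabilityMeasure P]
    {X : ℕ → Ω → E} {χ : ℕ → Ω → ℝ} {Λ : Measure E} [SigmaFinite Λ] {ω : ℝ} {δ : ℝ≥0}
    (hX : IsIndepMarkedPoisson X χ Λ (logNormalDB ω δ) P) {α κ : ℝ} (hκ : 0 ≤ κ)
    (d : ℕ) (hball : ∀ s, 0 < s → Λ (Metric.ball 0 s) = ENNReal.ofReal (κ * s ^ d))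
    {r : ℝ} (hr : 0 < r) :
    P {w | r ≤ nearestDist (displaced α X χ) w} =
      ENNReal.ofReal (Real.exp (-(κ * (∫ c, c ^ (d / α) ∂(logNormalDB ω δ)) * r ^ d))) := by
  let C : Set (E × ℝ) := {p | |p.2 ^ (-(1 / α))| * ‖p.1‖ < r}
  have hC : MeasurableSet C := measurableSet_lt
    ((measurable_abs.comp (measurable_snd.pow_const _)).mul (measurable_norm.comp measurable_fst))
    measurable_const
  have hset : {w | r ≤ nearestDist (displaced α X χ) w} = {w | ∀ n, (X n w, χ n w) ∉ C} := by
    ext w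
    simp [le_nearestDist_iff, displaced, norm_smul, C]
  have hm : 0 ≤ ∫ c, c ^ (d / α) ∂(logNormalDB ω δ) := (integral_rpow_logNormalDB_pos ω δ _).le
  have hint : ∫⁻ x, logNormalDB ω δ (Prod.mk x ⁻¹' C) ∂Λ =
      ENNReal.ofReal (κ * (∫ c, c ^ (d / α) ∂(logNormalDB ω δ)) * r ^ d) := by
    -- With the order of integration exchanged, the mark `c` is fixed and the section of `C` is a
    -- ball of radius `r * c ^ (1 / α)`; this produces the moment of order `d / α`.
    rw [← Measure.prod_apply hC, Measure.prod_apply_symm hC]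
    have hpt : ∀ᵐ c ∂(logNormalDB ω δ), Λ ((fun x => (x, c)) ⁻¹' C) =
        ENNReal.ofReal (κ * r ^ d) * ENNReal.ofReal (c ^ (d / α)) := by
      filter_upwards [ae_pos_logNormalDB ω δ] with c hc
      have hpos : 0 < c ^ (1 / α) := Real.rpow_pos_of_pos hc _
      have hpre : (fun x => (x, c)) ⁻¹' C = Metric.ball (0 : E) (r * c ^ (1 / α)) := by
        ext x
        simp only [C, Set.mem_preimage, Set.mem_ofPred_eq, mem_ball_zero_iff]
        rw [abs_of_pos (Real.rpow_pos_of_pos hc _), Real.rpow_neg hc.le, inv_mul_lt_iff₀ hpos,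
          mul_comm]
      rw [hpre, hball _ (mul_pos hr hpos), ← ENNReal.ofReal_mul (by positivity), mul_pow,
        ← Real.rpow_mul_natCast hc.le]
      congr 1
      rw [one_div_mul_eq_div]
      ring
    rw [lintegral_congr_ae hpt, lintegral_const_mul _ (by fun_prop),
      ← ofReal_integral_eq_lintegral_ofReal (integrable_rpow_logNormalDB ω δ _)
        ((ae_pos_logNormalDB ω δ).mono fun c hc => (Real.rpow_pos_of_pos hc _).le),
      ← ENNReal.ofReal_mul (by positivity)]
    congr 1
    ring
  rw [hset, hX.measure_forall_notMem hC (by rw [hint]; exact ENNReal.ofReal_ne_top), hint,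
    ENNReal.toReal_ofReal (by positivity)]

end NearestDist

/-! ### Comparison of independent distances -/

section Survival

variable {Ω : Type*} [MeasurableSpace Ω] {P : Measure Ω} [IsProbabilityMeasure P]

/-- Let `r` decrease to 0 in the survival function; `d ≠ 0` makes the limit 1. -/
lemma ae_pos_of_measure_le_eq_exp {X : Ω → ℝ} (hX : Measurable X) {κ : ℝ} {d : ℕ} (hd : d ≠ 0)
    (h : ∀ r, 0 < r → P {w | r ≤ X w} = ENNReal.ofReal (Real.exp (-(κ * r ^ d)))) :
    ∀ᵐ w ∂P, 0 < X w := by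
  have hlim : Filter.Tendsto (fun r : ℝ => ENNReal.ofReal (Real.exp (-(κ * r ^ d))))
      (nhdsWithin 0 (Set.Ioi 0)) (nhds 1) := by
    have hc : Continuous fun r : ℝ => ENNReal.ofReal (Real.exp (-(κ * r ^ d))) :=
      ENNReal.continuous_ofReal.comp (by fun_prop)
    have := (hc.tendsto 0).mono_left (nhdsWithin_le_nhds (s := Set.Ioi 0))
    simpa [hd] using this
  have hone : P {w | 0 < X w} = 1 := by
    refine le_antisymm prob_le_one (le_of_tendsto hlim ?_)
    filter_upwards [self_mem_nhdsWithin] with r hr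
    rw [← h r hr]
    exact measure_mono fun w (hw : r ≤ X w) => lt_of_lt_of_le (Set.mem_Ioi.1 hr) hw
  exact (prob_compl_eq_zero_iff (measurableSet_lt measurable_const hX)).2 hone

lemma expMeasure_singleton (l x : ℝ) : expMeasure l {x} = 0 :=
  withDensity_absolutelyContinuous _ _ (measure_singleton x)

lemma expMeasure_Ici {l : ℝ} (hl : 0 < l) (a : ℝ) :
    expMeasure l (Set.Ici a) = ENNReal.ofReal (if 0 ≤ a then Real.exp (-(l * a)) else 1) := by
  have := isProbabilityMeasure_expMeasure hl
  have hIic : expMeasure l (Set.Iic a) =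
      ENNReal.ofReal (if 0 ≤ a then 1 - Real.exp (-(l * a)) else 0) := by
    rw [← ofReal_measureReal, ← cdf_eq_real, cdf_expMeasure_eq hl]
  have hIoi : expMeasure l (Set.Ioi a) =
      ENNReal.ofReal (if 0 ≤ a then Real.exp (-(l * a)) else 1) := by
    rw [← Set.compl_Iic, prob_compl_eq_one_sub measurableSet_Iic, hIic, ← ENNReal.ofReal_one,
      ← ENNReal.ofReal_sub]
    · congr 1
      split_ifs <;> ring
    · split_ifs with ha
      · exact sub_nonneg.2 (Real.exp_le_one_iff.2 (neg_nonpos.2 (mul_nonneg hl.le ha)))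
      · exact le_rfl
  rw [← hIoi, ← Set.Ioi_insert, ← Set.singleton_union,
    measure_union (by simp) measurableSet_Ioi, expMeasure_singleton, zero_add]

lemma map_eq_expMeasure {Y : Ω → ℝ} (hY : Measurable Y) (hY0 : ∀ w, 0 ≤ Y w) {l : ℝ} (hl : 0 < l)
    (h : ∀ r, 0 < r → P {w | r ≤ Y w} = ENNReal.ofReal (Real.exp (-(l * r)))) :
    P.map Y = expMeasure l := by
  have := Measure.isProbabilityMeasure_map hY.aemeasurable (μ := P)
  refine Measure.ext_of_Ici _ _ fun a => ?_
  rw [expMeasure_Ici hl, Measure.map_apply hY measurableSet_Ici]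
  rcases lt_or_ge 0 a with ha | ha
  · rw [if_pos ha.le]
    exact h a ha
  · have huniv : Y ⁻¹' Set.Ici a = Set.univ := Set.eq_univ_of_forall fun w => ha.trans (hY0 w)
    rw [huniv, measure_univ]
    split_ifs with h0
    · simp [le_antisymm ha h0]
    · simp

lemma lintegral_expMeasure (l : ℝ) {g : ℝ → ℝ≥0∞} (hg : Measurable g) :
    ∫⁻ x, g x ∂(expMeasure l) =
      ∫⁻ x in Set.Ioi 0, ENNReal.ofReal (l * Real.exp (-(l * x))) * g x := by
  have hm : Measurable (exponentialPDF l) := (measurable_exponentialPDFReal l).ennreal_ofReal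
  change ∫⁻ x, g x ∂(volume.withDensity (exponentialPDF l)) = _
  rw [lintegral_withDensity_eq_lintegral_mul _ hm hg, setLIntegral_congr Ioi_ae_eq_Ici,
    ← lintegral_indicator measurableSet_Ici]
  refine lintegral_congr fun x => ?_
  by_cases hx : 0 ≤ x
  · simp [exponentialPDF_eq, hx]
  · simp [exponentialPDF_eq, hx]

lemma integrableOn_exp_neg_sub {l : ℝ} (hl : 0 < l) {f : ℝ → ℝ} (hf : Measurable f)
    (hf0 : ∀ x, 0 < x → 0 ≤ f x) :
    IntegrableOn (fun x => l * Real.exp (-f x - l * x)) (Set.Ioi 0) := by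
  refine Integrable.mono' ((exp_neg_integrableOn_Ioi 0 hl).const_mul l)
    (by fun_prop) ?_
  filter_upwards [ae_restrict_mem measurableSet_Ioi] with x hx
  rw [Real.norm_of_nonneg (by positivity)]
  gcongr
  have := hf0 x hx
  linarith

/-- Conditioning on `Y = y` leaves the survival function of `X` at `φ y`, weighted by the
exponential density. -/
lemma measureReal_le_of_indepFun {X Y : Ω → ℝ} (hX : Measurable X) (hY : Measurable Y)
    (hXY : IndepFun X Y P) {κ l : ℝ} {d : ℕ} (hl : 0 < l)
    (hXlaw : ∀ r, 0 < r → P {w | r ≤ X w} = ENNReal.ofReal (Real.exp (-(κ * r ^ d))))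
    (hYlaw : P.map Y = expMeasure l) {φ : ℝ → ℝ} (hφ : Measurable φ)
    (hφ0 : ∀ y, 0 < y → 0 < φ y) :
    P.real {w | φ (Y w) ≤ X w} =
      ∫ y in Set.Ioi 0, l * Real.exp (-(κ * φ y ^ d) - l * y) := by
  have := Measure.isProbabilityMeasure_map hX.aemeasurable (μ := P)
  have := isProbabilityMeasure_expMeasure hl
  have hD : MeasurableSet {p : ℝ × ℝ | φ p.2 ≤ p.1} :=
    measurableSet_le (hφ.comp measurable_snd) measurable_fst
  have hlaw := (indepFun_iff_map_prod_eq_prod_map_map hX.aemeasurable hY.aemeasurable).1 hXY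
  have hP : P {w | φ (Y w) ≤ X w} =
      ∫⁻ y in Set.Ioi 0, ENNReal.ofReal (l * Real.exp (-(κ * φ y ^ d) - l * y)) := by
    have h1 := Measure.map_apply (μ := P) (hX.prodMk hY) hD
    rw [hlaw, hYlaw, Measure.prod_apply_symm hD,
      lintegral_expMeasure l (measurable_measure_prodMk_right hD)] at h1
    refine h1.symm.trans (setLIntegral_congr_fun measurableSet_Ioi fun y hy => ?_)
    have h2 : P.map X ((fun x => (x, y)) ⁻¹' {p : ℝ × ℝ | φ p.2 ≤ p.1}) =
        ENNReal.ofReal (Real.exp (-(κ * φ y ^ d))) := by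
      rw [Measure.map_apply hX (measurable_prodMk_right hD)]
      exact hXlaw _ (hφ0 y hy)
    simp only [h2]
    rw [← ENNReal.ofReal_mul (by positivity), mul_assoc, ← Real.exp_add]
    congr 3
    ring
  have hmeas : Measurable fun y => l * Real.exp (-(κ * φ y ^ d) - l * y) := by fun_prop
  rw [measureReal_def, hP, integral_eq_lintegral_of_nonneg_ae
    (ae_of_all _ fun y => by positivity) hmeas.aestronglyMeasurable]

/-- The law of `Y` has no atoms, so by Fubini the graph of `ψ` is null for the joint law. This rules
out ties. -/
lemma ae_ne_of_indepFun {X Y : Ω → ℝ} (hX : Measurable X) (hY : Measurable Y)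
    (hXY : IndepFun X Y P) {l : ℝ} (hl : 0 < l) (hYlaw : P.map Y = expMeasure l) {ψ : ℝ → ℝ}
    (hψ : Measurable ψ) : ∀ᵐ w ∂P, Y w ≠ ψ (X w) := by
  have := Measure.isProbabilityMeasure_map hX.aemeasurable (μ := P)
  have := isProbabilityMeasure_expMeasure hl
  have hD : MeasurableSet {p : ℝ × ℝ | p.2 = ψ p.1} :=
    measurableSet_eq_fun measurable_snd (hψ.comp measurable_fst)
  have hlaw := (indepFun_iff_map_prod_eq_prod_map_map hX.aemeasurable hY.aemeasurable).1 hXY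
  have h1 := Measure.map_apply (μ := P) (hX.prodMk hY) hD
  rw [hlaw, hYlaw, Measure.prod_apply hD] at h1
  have h2 : ∀ x, expMeasure l (Prod.mk x ⁻¹' {p : ℝ × ℝ | p.2 = ψ p.1}) = 0 := fun x =>
    expMeasure_singleton l (ψ x)
  simp only [h2, lintegral_zero] at h1
  exact compl_mem_ae_iff.2 h1.symm

end Survival

/-! ### Gaussian integral and power inequalities -/

/-- Completing the square in the Laplace transform of a half-Gaussian. -/
lemma integral_Ioi_exp_neg_sq_sub {a l : ℝ} (ha : 0 < a) :
    ∫ x in Set.Ioi (0 : ℝ), 2 * l * Real.exp (-(a * x ^ 2) - 2 * l * x) =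
      l * Real.sqrt Real.pi / Real.sqrt a * Real.exp (l ^ 2 / a) * erfc (l / Real.sqrt a) := by
  have hs : 0 < Real.sqrt a := Real.sqrt_pos.2 ha
  have hss : Real.sqrt a ^ 2 = a := Real.sq_sqrt ha.le
  have hshift : ∫ x in Set.Ioi (l / Real.sqrt a), Real.exp (-x ^ 2) =
      ∫ x in Set.Ioi (0 : ℝ), Real.exp (-(x + l / Real.sqrt a) ^ 2) := by
    have := (measurePreserving_add_right volume (l / Real.sqrt a)).setIntegral_preimage_emb
      (measurableEmbedding_addRight _) (fun x => Real.exp (-x ^ 2)) (Set.Ioi (l / Real.sqrt a))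
    rw [← this]
    simp
  have hscale := integral_comp_mul_left_Ioi
    (fun x => Real.exp (-(x + l / Real.sqrt a) ^ 2)) 0 hs
  rw [mul_zero, ← hshift, smul_eq_mul] at hscale
  -- Uses `a x² + 2 l x = (√a x + l / √a)² - l² / a`.
  have hpt : ∀ x : ℝ, 2 * l * Real.exp (-(a * x ^ 2) - 2 * l * x) =
      2 * l * Real.exp (l ^ 2 / a) * Real.exp (-(Real.sqrt a * x + l / Real.sqrt a) ^ 2) := by
    intro x
    rw [mul_assoc (2 * l), ← Real.exp_add]
    congr 2
    rw [add_sq, mul_pow, div_pow, hss]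
    field_simp
    ring
  simp_rw [hpt]
  rw [integral_const_mul, hscale, erfc]
  have : Real.sqrt Real.pi ≠ 0 := (Real.sqrt_pos.2 Real.pi_pos).ne'
  field_simp

lemma mul_rpow_neg_le_rpow_neg_iff {A a b x y : ℝ} (hA : 0 < A) (ha : 0 < a) (hx : 0 < x)
    (hy : 0 < y) :
    A * x ^ (-a) ≤ y ^ (-b) ↔ A ^ (1 / a) * y ^ (b / a) ≤ x := by
  have hA1 : A ^ (1 / a) * y ^ (b / a) = (A * y ^ b) ^ (1 / a) := by
    rw [Real.mul_rpow hA.le (by positivity), ← Real.rpow_mul hy.le, mul_one_div]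
  have hxa : x = (x ^ a) ^ (1 / a) := by
    rw [← Real.rpow_mul hx.le, mul_one_div, div_self ha.ne', Real.rpow_one]
  have hxp : 0 < x ^ a := by positivity
  have hyp : 0 < y ^ b := by positivity
  rw [hA1]
  nth_rw 2 [hxa]
  rw [Real.rpow_le_rpow_iff (by positivity) hxp.le (by positivity), Real.rpow_neg hx.le,
    Real.rpow_neg hy.le, ← div_eq_mul_inv, inv_eq_one_div, div_le_div_iff₀ hxp hyp, one_mul]

lemma eq_rpow_of_mul_rpow_neg_eq {A a b x y : ℝ} (hb : b ≠ 0) (hy : 0 < y)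
    (h : A * x ^ (-a) = y ^ (-b)) : y = (A * x ^ (-a)) ^ (-(1 / b)) := by
  rw [h, ← Real.rpow_mul hy.le]
  field_simp
  simp

/-! ### Association probabilities -/

theorem lemma3 {Ω : Type*} [MeasurableSpace Ω] (P : Measure Ω) [IsProbabilityMeasure P]
    -- transmit powers, antenna gains, path-loss exponents, densities, shadowing parameters
    (PM PS PV GM GS0 GV0 GV1 αM αS lam_m lam_s ωM ωS : ℝ) (δM δS : ℝ≥0)
    (hPM : 0 < PM) (hPS : 0 < PS) (hPV : 0 < PV)
    (hGM : 0 < GM) (hGS0 : 0 < GS0) (hGV0 : 0 < GV0) (hGV1 : 0 < GV1)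
    (hαM : 0 < αM) (hαS : 0 < αS) (hlam_m : 0 < lam_m) (hlam_s : 0 < lam_s)
    -- MBSs in the plane and SBSs on the typical road (a line through the typical vehicle at the
    -- origin), with their shadowing coefficients
    (XM : ℕ → Ω → EuclideanSpace ℝ (Fin 2)) (χM : ℕ → Ω → ℝ)
    (XS : ℕ → Ω → ℝ) (χS : ℕ → Ω → ℝ)
    (hM : IsIndepMarkedPoisson XM χM (ENNReal.ofReal lam_m • volume) (logNormalDB ωM δM) P)
    (hS : IsIndepMarkedPoisson XS χS (ENNReal.ofReal lam_s • volume) (logNormalDB ωS δS) P)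
    (hMS : IndepFun (fun w n => (XM n w, χM n w)) (fun w n => (XS n w, χS n w)) P)
    -- distances to the nearest MBS and SBS after the random displacement
    (xM xS : Ω → ℝ)
    (hxM : xM = nearestDist (displaced αM XM χM))
    (hxS : xS = nearestDist (displaced αS XS χS))
    -- densities after the random displacement, and the two power-gain ratios
    (lamM lamS A B : ℝ)
    (hlamM : lamM = (∫ c, c ^ (2 / αM) ∂(logNormalDB ωM δM)) * lam_m)
    (hlamS : lamS = (∫ c, c ^ (1 / αS) ∂(logNormalDB ωS δS)) * lam_s)
    (hA : A = (PM * GM) / (PS * GS0)) (hB : B = (PV * GV1) / (PV * GV0))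
    (hAB : B < A)
    -- Case 3: UL to an MBS, DL to an SBS; Case 4: UL and DL to SBSs
    (case3 case4 : Set Ω)
    (hcase3 : case3 = {w | AssocMBS (PV * GV1) (PV * GV0) αM αS (xM w) (xS w) ∧
      ¬ AssocMBS (PM * GM) (PS * GS0) αM αS (xM w) (xS w)})
    (hcase4 : case4 = {w | ¬ AssocMBS (PV * GV1) (PV * GV0) αM αS (xM w) (xS w) ∧
      ¬ AssocMBS (PM * GM) (PS * GS0) αM αS (xM w) (xS w)}) :
    IntegrableOn (fun x : ℝ => 2 * lamS *
        Real.exp (-(lamM * Real.pi * A ^ (2 / αM) * x ^ (2 * αS / αM)) - 2 * lamS * x))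
      (Set.Ioi 0) ∧
    P.real case4 = ∫ x in Set.Ioi (0 : ℝ), 2 * lamS *
        Real.exp (-(lamM * Real.pi * A ^ (2 / αM) * x ^ (2 * αS / αM)) - 2 * lamS * x) ∧
    -- the same event up to ties, which have probability zero
    P.real {w | A * xM w ^ (-αM) < xS w ^ (-αS) ∧ B * xM w ^ (-αM) < xS w ^ (-αS)} =
      P.real case4 ∧
    (αS = αM → P.real case4 =
      Real.sqrt (lamS ^ 2 / (lamM * A ^ (2 / αM))) *
        Real.exp (lamS ^ 2 / (lamM * Real.pi * A ^ (2 / αM))) *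
        erfc (lamS / Real.sqrt (lamM * Real.pi * A ^ (2 / αM)))) ∧
    P case3 = 0 := by
  have hA0 : 0 < A := by rw [hA]; positivity
  have hlamM0 : 0 < lamM := by
    rw [hlamM]; exact mul_pos (integral_rpow_logNormalDB_pos _ _ _) hlam_m
  have hlamS0 : 0 < lamS := by
    rw [hlamS]; exact mul_pos (integral_rpow_logNormalDB_pos _ _ _) hlam_s
  have hlS : 0 < 2 * lamS := by positivity
  have hxM0 : ∀ w, 0 ≤ xM w := fun w => by rw [hxM]; exact nearestDist_nonneg _ w
  have hxS0 : ∀ w, 0 ≤ xS w := fun w => by rw [hxS]; exact nearestDist_nonneg _ w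
  have hdistM : Measurable fun p : ℕ → EuclideanSpace ℝ (Fin 2) × ℝ =>
    ⨅ n, |(p n).2 ^ (-(1 / αM))| * ‖(p n).1‖ := measurable_iInf_abs_rpow_mul_norm αM
  have hdistS : Measurable fun p : ℕ → ℝ × ℝ =>
    ⨅ n, |(p n).2 ^ (-(1 / αS))| * ‖(p n).1‖ := measurable_iInf_abs_rpow_mul_norm αS
  have hxM_eq : xM = (fun p : ℕ → EuclideanSpace ℝ (Fin 2) × ℝ =>
      ⨅ n, |(p n).2 ^ (-(1 / αM))| * ‖(p n).1‖) ∘ fun w n => (XM n w, χM n w) := by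
    rw [hxM]; exact funext fun w => nearestDist_displaced αM XM χM w
  have hxS_eq : xS = (fun p : ℕ → ℝ × ℝ =>
      ⨅ n, |(p n).2 ^ (-(1 / αS))| * ‖(p n).1‖) ∘ fun w n => (XS n w, χS n w) := by
    rw [hxS]; exact funext fun w => nearestDist_displaced αS XS χS w
  have hmM : Measurable xM := by
    rw [hxM_eq]
    exact hdistM.comp (measurable_pi_lambda _ fun n =>
      (hM.points.measurable n).prodMk (hM.marks_measurable n))
  have hmS : Measurable xS := by
    rw [hxS_eq]
    exact hdistS.comp (measurable_pi_lambda _ fun n =>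
      (hS.points.measurable n).prodMk (hS.marks_measurable n))
  have hind : IndepFun xM xS P := by
    rw [hxM_eq, hxS_eq]; exact hMS.comp hdistM hdistS
  have hlawM : ∀ r, 0 < r →
      P {w | r ≤ xM w} = ENNReal.ofReal (Real.exp (-(lamM * Real.pi * r ^ 2))) := fun r hr => by
    -- `ENNReal.ofReal` unfolds to a coerced `ℝ≥0`, a finite scalar, which keeps the measure
    -- σ-finite.
    have : SigmaFinite (ENNReal.ofReal lam_m • (volume : Measure (EuclideanSpace ℝ (Fin 2)))) :=
      inferInstanceAs (SigmaFinite (lam_m.toNNReal • volume))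
    rw [hxM, measure_le_nearestDist_displaced hM (κ := lam_m * Real.pi) (by positivity) 2 ?_ hr,
      hlamM]
    · congr 3
      push_cast
      ring
    · intro s hs
      rw [Measure.smul_apply, EuclideanSpace.volume_ball_fin_two, smul_eq_mul,
        ← ENNReal.ofReal_pow hs.le, ← ENNReal.ofReal_mul (by positivity),
        ← ENNReal.ofReal_mul (by positivity)]
      congr 1
      ring
  have hsurvS : ∀ r, 0 < r →
      P {w | r ≤ xS w} = ENNReal.ofReal (Real.exp (-(2 * lamS * r))) := fun r hr => by
    have : SigmaFinite (ENNReal.ofReal lam_s • (volume : Measure ℝ)) :=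
      inferInstanceAs (SigmaFinite (lam_s.toNNReal • volume))
    rw [hxS, measure_le_nearestDist_displaced hS (κ := 2 * lam_s) (by positivity) 1 ?_ hr, hlamS]
    · congr 3
      push_cast
      ring
    · intro s hs
      rw [Measure.smul_apply, Real.volume_ball, smul_eq_mul, ← ENNReal.ofReal_mul (by positivity)]
      congr 1
      ring
  have hlawS : P.map xS = expMeasure (2 * lamS) := map_eq_expMeasure hmS hxS0 hlS hsurvS
  have hposM : ∀ᵐ w ∂P, 0 < xM w := ae_pos_of_measure_le_eq_exp hmM two_ne_zero hlawM
  have hposS : ∀ᵐ w ∂P, 0 < xS w :=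
    ae_pos_of_measure_le_eq_exp hmS one_ne_zero (by simpa only [pow_one] using hsurvS)
  have hnotDL : ∀ w, ¬ AssocMBS (PM * GM) (PS * GS0) αM αS (xM w) (xS w) ↔
      A * xM w ^ (-αM) ≤ xS w ^ (-αS) := fun w => by
    rw [AssocMBS, not_lt, hA, div_mul_eq_mul_div, div_le_iff₀ (by positivity),
      mul_comm (xS w ^ (-αS))]
  have hnotUL : ∀ w, ¬ AssocMBS (PV * GV1) (PV * GV0) αM αS (xM w) (xS w) ↔
      B * xM w ^ (-αM) ≤ xS w ^ (-αS) := fun w => by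
    rw [AssocMBS, not_lt, hB, div_mul_eq_mul_div, div_le_iff₀ (by positivity),
      mul_comm (xS w ^ (-αS))]
  have hBA : ∀ w, B * xM w ^ (-αM) ≤ A * xM w ^ (-αM) := fun w =>
    mul_le_mul_of_nonneg_right hAB.le (Real.rpow_nonneg (hxM0 w) _)
  have hcase4_eq : case4 = {w | A * xM w ^ (-αM) ≤ xS w ^ (-αS)} := by
    rw [hcase4]
    ext w
    simp only [Set.mem_ofPred_eq, hnotDL, hnotUL]
    exact ⟨fun h => h.2, fun h => ⟨(hBA w).trans h, h⟩⟩
  -- Empty, not merely null: `hBA` holds even where a distance vanishes.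
  have hcase3_eq : case3 = ∅ := by
    rw [hcase3]
    refine Set.eq_empty_of_forall_notMem fun w hw => ?_
    exact (hnotUL w).2 ((hBA w).trans ((hnotDL w).1 hw.2)) hw.1
  have hφ2 : ∀ x : ℝ, 0 < x → lamM * Real.pi * (A ^ (1 / αM) * x ^ (αS / αM)) ^ 2 =
      lamM * Real.pi * A ^ (2 / αM) * x ^ (2 * αS / αM) := fun x hx => by
    rw [mul_pow, ← Real.rpow_mul_natCast hA0.le, ← Real.rpow_mul_natCast hx.le, ← mul_assoc]
    congr 2
    · congr 1
      push_cast
      ring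
    · push_cast
      ring
  have hprob : P.real case4 = ∫ x in Set.Ioi (0 : ℝ), 2 * lamS *
      Real.exp (-(lamM * Real.pi * A ^ (2 / αM) * x ^ (2 * αS / αM)) - 2 * lamS * x) := by
    -- Only almost everywhere: at distance 0 the convention `0 ^ (-α) = 0` would break the
    -- equivalence.
    have hae : case4 =ᵐ[P] {w | A ^ (1 / αM) * xS w ^ (αS / αM) ≤ xM w} := by
      rw [hcase4_eq]
      filter_upwards [hposM, hposS] with w hwM hwS
      exact propext (mul_rpow_neg_le_rpow_neg_iff hA0 hαM hwM hwS)
    rw [measureReal_congr hae, measureReal_le_of_indepFun hmM hmS hind hlS hlawM hlawS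
      (φ := fun y => A ^ (1 / αM) * y ^ (αS / αM)) (by fun_prop) fun y hy => by positivity]
    refine setIntegral_congr_fun measurableSet_Ioi fun x hx => ?_
    simp only [hφ2 x hx]
  refine ⟨?_, hprob, ?_, ?_, ?_⟩
  · exact integrableOn_exp_neg_sub hlS
      (f := fun x => lamM * Real.pi * A ^ (2 / αM) * x ^ (2 * αS / αM)) (by fun_prop)
      fun x hx => by positivity
  · refine measureReal_congr ?_
    rw [hcase4_eq]
    filter_upwards [hposS, ae_ne_of_indepFun hmM hmS hind hlS hlawS
      (ψ := fun x => (A * x ^ (-αM)) ^ (-(1 / αS))) (by fun_prop)] with w hwS hne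
    refine propext ⟨fun h => h.1.le, fun h => ?_⟩
    have hlt : A * xM w ^ (-αM) < xS w ^ (-αS) := lt_of_le_of_ne h fun heq =>
      hne (eq_rpow_of_mul_rpow_neg_eq hαS.ne' hwS heq)
    exact ⟨hlt, (hBA w).trans_lt hlt⟩
  · rintro rfl
    have hAp : 0 < A ^ (2 / αS) := by positivity
    have hexp : 2 * αS / αS = (2 : ℕ) := by push_cast; field_simp
    rw [hprob]
    simp_rw [hexp, Real.rpow_natCast]
    rw [integral_Ioi_exp_neg_sq_sub (by positivity), Real.sqrt_div (sq_nonneg _),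
      Real.sqrt_sq hlamS0.le]
    -- What remains is the prefactor, where the `√π` from `erfc` cancels the one in `√(lamM * π * A
    -- ^ (2 / αS))`.
    congr 2
    rw [mul_right_comm lamM, Real.sqrt_mul (by positivity)]
    have : Real.sqrt Real.pi ≠ 0 := (Real.sqrt_pos.2 Real.pi_pos).ne'
    field_simp
  · rw [hcase3_eq, measure_empty]
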